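/- Let $Z_1$ be a random variable with values in $[0,1]$, and let $\xi_1,\xi_2,\dots$ and $U_1,U_2,\dots$ be random variables uniformly distributed on $[0,1]$, such that $Z_1,\xi_1,\xi_2,\dots,U_1,U_2,\dots$ are all mutually independent. Put $L_1=R_1=1$ and define recursively, for $n\ge 1$, $$Z_{n+1}=Z_n(1-\xi_n)\mathbf 1_{\{U_n<\frac{L_n}{L_n+R_n}\}}+\bigl(Z_n+(1-Z_n)\xi_n\bigr)\mathbf 1_{\{U_n>\frac{L_n}{L_n+R_n}\}},$$ $$L_{n+1}=L_n+Z_n\mathbf 1_{\{U_n<\frac{L_n}{L_n+R_n}\}},\qquad R_{n+1}=R_n+(1-Z_n)\mathbf 1_{\{U_n>\frac{L_n}{L_n+R_n}\}}.$$ (Thus, given the past, with probability $L_n/(L_n+R_n)$ the particle jumps left, to a uniform point of $[0,Z_n]$, and $L_n$ grows by $Z_n$; otherwise it jumps right, to a uniform point of $[Z_n,1]$, and $R_n$ grows by $1-Z_n$.) Then, as $n\to\infty$, $Z_n$ converges in distribution to the arcsine law $\mathrm{Beta}\left(\tfrac12,\tfrac12\right)$, i.e. the distribution with density $\frac{1}{\pi\sqrt{x(1-x)}}$,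 $0<x<1$. -/

import Mathlib

open MeasureTheory ProbabilityTheory Filter

/-- One step of the urn-driven random walk on `[0, 1]`. A state is a triple `(z, l, r)`: the position
`z` of the particle and the two quantities `l`, `r` in the urn. If `u < l / (l + r)` the particle
jumps left to `z * (1 - ξL)` and `l` grows by `h z`; if `u > l / (l + r)` it jumps right to
`z + (1 - z) * ξR` and `r` grows by `h (1 - z)`. -/
noncomputable def urnStep (h : ℝ → ℝ) (ξL ξR u : ℝ) (s : ℝ × ℝ × ℝ) : ℝ × ℝ × ℝ :=
  ((if u < s.2.1 / (s.2.1 + s.2.2) then s.1 * (1 - ξL) else 0) +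
      (if s.2.1 / (s.2.1 + s.2.2) < u then s.1 + (1 - s.1) * ξR else 0),
    s.2.1 + (if u < s.2.1 / (s.2.1 + s.2.2) then h s.1 else 0),
    s.2.2 + (if s.2.1 / (s.2.1 + s.2.2) < u then h (1 - s.1) else 0))

/-- The process `(Z, L, R)` started from position `Z₁` and urn content `(1, 1)` and driven by the
random variables `ξL`, `ξR`, `U`. Time is counted from `0`: index `n` is the state after `n`
steps. -/
noncomputable def urnProcess {Ω : Type*} (h : ℝ → ℝ) (Z₁ : Ω → ℝ) (ξL ξR U : ℕ → Ω → ℝ) :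
    ℕ → Ω → ℝ × ℝ × ℝ
  | 0, ω => (Z₁ ω, 1, 1)
  | n + 1, ω => urnStep h (ξL n ω) (ξR n ω) (U n ω) (urnProcess h Z₁ ξL ξR U n ω)

/-- The arcsine law `Beta(1/2, 1/2)` is a probability measure. -/
instance isProbabilityMeasure_arcsine :
    IsProbabilityMeasure (betaMeasure (1 / 2) (1 / 2)) :=
  isProbabilityMeasureBeta one_half_pos one_half_pos

/-!
Write `S = L + R` for the content of the urn and `q = R / S` for the probability of a jump to the
right. If `q` were constant, the position would be a contracting Markov chain on `[0, 1]` with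
stationary law `Beta(q, 1 - q)`. The proof shows that `q → 1 / 2` in mean, and then reads off the
limit law from the moments of the position.

*The urn balances.* Put `M = L - R + 2 Z`. In a jump to the left `M` changes by `Z (1 - 2 ξ)` while `S`
grows by `Z`; in a jump to the right `M` changes by `(1 - Z) (2 ξ - 1)` while `S` grows by `1 - Z`.
So `M` is a martingale, even conditionally on the direction of the jump, and the square of its
increment is dominated by the growth of `S`. Hence `M² / S^{3/2} + S^{-1/2}` is a supermartingale
(`jumpMean_urnEnergy_le`), so that `M² / S^{3/2}` stays bounded in mean. Since `L, R ≥ 1`, the mean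
growth of `S` in one step is at least `1 / S`, and this forces the mean of `S⁻³` to `0`
(`IsUrnChain.tendsto_integral_inv_cube`). As `|q - 1 / 2| ≤ (|M| + 2) / (2 S)`, both facts together
give `E |q - 1 / 2| → 0` (`IsUrnChain.tendsto_integral_abs_right_prob_sub`).

*The moments converge.* A uniform jump sends `z ^ k` in the mean to
`(z ^ k + q (1 + z + ⋯ + z ^ (k - 1))) / (k + 1)` (`jumpMean_pow`). With `q → 1 / 2` this is a
contracting recursion for the `k`-th moment, whose limit is determined by the lower moments through
`2 k m k = m 0 + ⋯ + m (k - 1)` (`IsUrnChain.tendsto_integral_pow`). The arcsine law has such moments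
(`arcsine_moment_sum`), and on `[0, 1]` convergence of moments implies weak convergence
(`tendsto_of_tendsto_integral_pow`).

Conditional expectations are avoided: the independence of the driving variables enters only through
the identity `E F(X (n + 1)) = E (jumpMean F)(X n)` for bounded measurable `F`
(`isUrnChain_urnProcess`).
-/

/-! ### One step of the walk -/

/-- The states that the walk can reach in `n` steps: positions in `[0, 1]`, and urn contents between
`1` and `n + 1`. -/
def urnStates (n : ℕ) : Set (ℝ × ℝ × ℝ) :=
  {s | s.1 ∈ Set.Icc (0 : ℝ) 1 ∧ s.2.1 ∈ Set.Icc (1 : ℝ) (n + 1) ∧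
    s.2.2 ∈ Set.Icc (1 : ℝ) (n + 1)}

/-- The transition operator of the chain `(Z, L, R)`: the mean of `F` after one step from the
state `s`. -/
noncomputable def jumpMean (F : ℝ × ℝ × ℝ → ℝ) (s : ℝ × ℝ × ℝ) : ℝ :=
  (∫ x in (0 : ℝ)..1, F (s.1 * (1 - x), s.2.1 + s.1, s.2.2)) * (s.2.1 / (s.2.1 + s.2.2)) +
    (∫ x in (0 : ℝ)..1, F (s.1 + (1 - s.1) * x, s.2.1, s.2.2 + (1 - s.1))) *
      (s.2.2 / (s.2.1 + s.2.2))

/-- The uniform distribution on `[0, 1]`. -/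
noncomputable abbrev unitUniform : Measure ℝ := volume.restrict (Set.Icc (0 : ℝ) 1)

instance isProbabilityMeasure_unitUniform : IsProbabilityMeasure unitUniform :=
  ⟨by simp⟩

lemma map_eq_unitUniform {Ω : Type*} [MeasurableSpace Ω] {P : Measure Ω} {ξ : Ω → ℝ}
    (hξ : pdf.IsUniform ξ (Set.Icc (0 : ℝ) 1) P volume) : P.map ξ = unitUniform := by
  rw [hξ, ProbabilityTheory.cond]
  simp

lemma aemeasurable_of_isUniform_unit {Ω : Type*} [MeasurableSpace Ω] {P : Measure Ω} {ξ : Ω → ℝ}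
    (hξ : pdf.IsUniform ξ (Set.Icc (0 : ℝ) 1) P volume) : AEMeasurable ξ P :=
  hξ.aemeasurable (by simp) (by simp)

lemma ae_mem_Icc_of_isUniform_unit {Ω : Type*} [MeasurableSpace Ω] {P : Measure Ω} {ξ : Ω → ℝ}
    (hξ : pdf.IsUniform ξ (Set.Icc (0 : ℝ) 1) P volume) :
    ∀ᵐ ω ∂P, ξ ω ∈ Set.Icc (0 : ℝ) 1 := by
  refine ae_of_ae_map (aemeasurable_of_isUniform_unit hξ) ?_
  rw [map_eq_unitUniform hξ]
  exact ae_restrict_mem measurableSet_Icc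

lemma urnStates_pos {n : ℕ} {s : ℝ × ℝ × ℝ} (hs : s ∈ urnStates n) : 0 < s.2.1 + s.2.2 := by
  obtain ⟨-, ⟨h, -⟩, ⟨h', -⟩⟩ := hs
  linarith

lemma left_mem_urnStates {n : ℕ} {s : ℝ × ℝ × ℝ} (hs : s ∈ urnStates n) {x : ℝ}
    (hx : x ∈ Set.Icc (0 : ℝ) 1) : (s.1 * (1 - x), s.2.1 + s.1, s.2.2) ∈ urnStates (n + 1) := by
  obtain ⟨⟨h1, h2⟩, ⟨h3, h4⟩, ⟨h5, h6⟩⟩ := hs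
  obtain ⟨hx0, hx1⟩ := hx
  refine ⟨⟨?_, ?_⟩, ⟨?_, ?_⟩, ⟨?_, ?_⟩⟩ <;> simp only [] <;> push_cast <;> nlinarith

lemma right_mem_urnStates {n : ℕ} {s : ℝ × ℝ × ℝ} (hs : s ∈ urnStates n) {x : ℝ}
    (hx : x ∈ Set.Icc (0 : ℝ) 1) :
    (s.1 + (1 - s.1) * x, s.2.1, s.2.2 + (1 - s.1)) ∈ urnStates (n + 1) := by
  obtain ⟨⟨h1, h2⟩, ⟨h3, h4⟩, ⟨h5, h6⟩⟩ := hs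
  obtain ⟨hx0, hx1⟩ := hx
  refine ⟨⟨?_, ?_⟩, ⟨?_, ?_⟩, ⟨?_, ?_⟩⟩ <;> simp only [] <;> push_cast <;> nlinarith

lemma urnStep_of_lt {x u : ℝ} {s : ℝ × ℝ × ℝ} (h : u < s.2.1 / (s.2.1 + s.2.2)) :
    urnStep (fun x => x) x x u s = (s.1 * (1 - x), s.2.1 + s.1, s.2.2) := by
  simp [urnStep, h, not_lt.2 h.le]

lemma urnStep_of_gt {x u : ℝ} {s : ℝ × ℝ × ℝ} (h : s.2.1 / (s.2.1 + s.2.2) < u) :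
    urnStep (fun x => x) x x u s = (s.1 + (1 - s.1) * x, s.2.1, s.2.2 + (1 - s.1)) := by
  simp [urnStep, h, not_lt.2 h.le]

lemma urnStep_mem_urnStates {n : ℕ} {s : ℝ × ℝ × ℝ} (hs : s ∈ urnStates n) {x u : ℝ}
    (hx : x ∈ Set.Icc (0 : ℝ) 1) : urnStep (fun x => x) x x u s ∈ urnStates (n + 1) := by
  rcases lt_trichotomy u (s.2.1 / (s.2.1 + s.2.2)) with h | h | h
  · rw [urnStep_of_lt h]
    exact left_mem_urnStates hs hx
  · -- In the null event of a tie the recursion puts the particle at `0`.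
    obtain ⟨⟨h1, h2⟩, ⟨h3, h4⟩, ⟨h5, h6⟩⟩ := hs
    simp only [urnStep, h, lt_irrefl, if_false, urnStates, Set.mem_ofPred_eq, Set.mem_Icc]
    refine ⟨⟨?_, ?_⟩, ⟨?_, ?_⟩, ⟨?_, ?_⟩⟩ <;> push_cast <;> linarith
  · rw [urnStep_of_gt h]
    exact right_mem_urnStates hs hx

lemma measurable_urnStep :
    Measurable fun w : (ℝ × ℝ × ℝ) × ℝ × ℝ => urnStep (fun x => x) w.2.1 w.2.1 w.2.2 w.1 := by
  have h1 : MeasurableSet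
      {w : (ℝ × ℝ × ℝ) × ℝ × ℝ | w.2.2 < w.1.2.1 / (w.1.2.1 + w.1.2.2)} :=
    measurableSet_lt (by fun_prop) (by fun_prop)
  have h2 : MeasurableSet
      {w : (ℝ × ℝ × ℝ) × ℝ × ℝ | w.1.2.1 / (w.1.2.1 + w.1.2.2) < w.2.2} :=
    measurableSet_lt (by fun_prop) (by fun_prop)
  unfold urnStep
  refine Measurable.prodMk (Measurable.add (Measurable.ite h1 ?_ ?_) (Measurable.ite h2 ?_ ?_))
    (Measurable.prodMk (Measurable.add ?_ (Measurable.ite h1 ?_ ?_))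
      (Measurable.add ?_ (Measurable.ite h2 ?_ ?_))) <;> fun_prop

lemma integral_urnStep_eq_jumpMean {n : ℕ} {s : ℝ × ℝ × ℝ} (hs : s ∈ urnStates n)
    {F : ℝ × ℝ × ℝ → ℝ} (hF : Measurable F) {C : ℝ} (hC : ∀ s ∈ urnStates (n + 1), |F s| ≤ C) :
    ∫ w, F (urnStep (fun x => x) w.1 w.1 w.2 s) ∂(unitUniform.prod unitUniform) =
      jumpMean F s := by
  set p := s.2.1 / (s.2.1 + s.2.2) with hp
  have hS := urnStates_pos hs
  have hp0 : 0 ≤ p := div_nonneg (by linarith [hs.2.1.1]) hS.le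
  have hp1 : p ≤ 1 := (div_le_one hS).2 (by linarith [hs.2.2.1])
  have hq : s.2.2 / (s.2.1 + s.2.2) = 1 - p := by rw [hp]; field_simp; ring
  set A : ℝ → ℝ := fun x => F (s.1 * (1 - x), s.2.1 + s.1, s.2.2) with hA
  set B : ℝ → ℝ := fun x => F (s.1 + (1 - s.1) * x, s.2.1, s.2.2 + (1 - s.1)) with hB
  have hAm : Measurable A := by fun_prop
  have hBm : Measurable B := by fun_prop
  have hAi : Integrable A unitUniform := by
    refine Integrable.of_bound hAm.aestronglyMeasurable C ?_
    filter_upwards [ae_restrict_mem measurableSet_Icc] with x hx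
    exact hC _ (left_mem_urnStates hs hx)
  have hBi : Integrable B unitUniform := by
    refine Integrable.of_bound hBm.aestronglyMeasurable C ?_
    filter_upwards [ae_restrict_mem measurableSet_Icc] with x hx
    exact hC _ (right_mem_urnStates hs hx)
  have hint : ∀ t : Set ℝ, MeasurableSet t →
      Integrable (t.indicator (fun _ => (1 : ℝ))) unitUniform :=
    fun t ht => (integrable_const _).indicator ht
  have hne : ∀ᵐ w : ℝ × ℝ ∂(unitUniform.prod unitUniform), w.2 ≠ p := by
    have h : ∀ᵐ u ∂unitUniform, u ≠ p := ae_restrict_of_ae (by simp [ae_iff])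
    exact Measure.quasiMeasurePreserving_snd.ae h
  have key : (fun w : ℝ × ℝ => F (urnStep (fun x => x) w.1 w.1 w.2 s))
      =ᵐ[unitUniform.prod unitUniform]
      fun w => A w.1 * (Set.Iio p).indicator (fun _ => (1 : ℝ)) w.2 +
        B w.1 * (Set.Ioi p).indicator (fun _ => (1 : ℝ)) w.2 := by
    filter_upwards [hne] with w hw
    rcases lt_or_gt_of_ne hw with h | h
    · rw [urnStep_of_lt h]
      simp [Set.indicator, h, h.not_gt, hA]
    · rw [urnStep_of_gt h]
      simp [Set.indicator, h, h.not_gt, hB]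
  have e1 : ∫ u, (Set.Iio p).indicator (fun _ => (1 : ℝ)) u ∂unitUniform = p := by
    rw [integral_indicator measurableSet_Iio, Measure.restrict_restrict measurableSet_Iio]
    have : Set.Iio p ∩ Set.Icc 0 1 = Set.Ico 0 p := by
      ext u; simp only [Set.mem_inter_iff, Set.mem_Iio, Set.mem_Icc, Set.mem_Ico]
      exact ⟨fun h => ⟨h.2.1, h.1⟩, fun h => ⟨h.2, h.1, h.2.le.trans hp1⟩⟩
    simp [this, hp0]
  have e2 : ∫ u, (Set.Ioi p).indicator (fun _ => (1 : ℝ)) u ∂unitUniform = 1 - p := by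
    rw [integral_indicator measurableSet_Ioi, Measure.restrict_restrict measurableSet_Ioi]
    have : Set.Ioi p ∩ Set.Icc 0 1 = Set.Ioc p 1 := by
      ext u; simp only [Set.mem_inter_iff, Set.mem_Ioi, Set.mem_Icc, Set.mem_Ioc]
      exact ⟨fun h => ⟨h.1, h.2.2⟩, fun h => ⟨h.1, hp0.trans h.1.le, h.2⟩⟩
    simp [this, hp1]
  rw [integral_congr_ae key, integral_add (hAi.mul_prod (hint _ measurableSet_Iio))
    (hBi.mul_prod (hint _ measurableSet_Ioi)), integral_prod_mul, integral_prod_mul, e1, e2,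
    jumpMean, hq, integral_Icc_eq_integral_Ioc, integral_Icc_eq_integral_Ioc,
    intervalIntegral.integral_of_le zero_le_one, intervalIntegral.integral_of_le zero_le_one]

/-- The Markov property in integrated form: one step from a random state, driven by an independent
pair of uniform variables, has the mean that the transition operator prescribes. -/
lemma integral_comp_urnStep {Ω : Type*} [MeasurableSpace Ω] {P : Measure Ω}
    [IsProbabilityMeasure P] {X : Ω → ℝ × ℝ × ℝ} {ξ U : Ω → ℝ} {n : ℕ} (hX : AEMeasurable X P)
    (hXn : ∀ᵐ ω ∂P, X ω ∈ urnStates n)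
    (hξ : pdf.IsUniform ξ (Set.Icc (0 : ℝ) 1) P volume)
    (hU : pdf.IsUniform U (Set.Icc (0 : ℝ) 1) P volume)
    (hXξU : IndepFun X (fun ω => (ξ ω, U ω)) P) (hξU : IndepFun ξ U P)
    {F : ℝ × ℝ × ℝ → ℝ} (hF : Measurable F) {C : ℝ} (hC : ∀ s ∈ urnStates (n + 1), |F s| ≤ C) :
    ∫ ω, F (urnStep (fun x => x) (ξ ω) (ξ ω) (U ω) (X ω)) ∂P = ∫ ω, jumpMean F (X ω) ∂P := by
  have hξm := aemeasurable_of_isUniform_unit hξ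
  have hUm := aemeasurable_of_isUniform_unit hU
  have hlaw : P.map (fun ω => (X ω, (ξ ω, U ω))) =
      (P.map X).prod (unitUniform.prod unitUniform) := by
    rw [(indepFun_iff_map_prod_eq_prod_map_map hX (hξm.prodMk hUm)).1 hXξU,
      (indepFun_iff_map_prod_eq_prod_map_map hξm hUm).1 hξU, map_eq_unitUniform hξ,
      map_eq_unitUniform hU]
  have hpair : AEMeasurable (fun ω => (X ω, (ξ ω, U ω))) P := hX.prodMk (hξm.prodMk hUm)
  set G : (ℝ × ℝ × ℝ) × ℝ × ℝ → ℝ :=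
    fun w => F (urnStep (fun x => x) w.2.1 w.2.1 w.2.2 w.1) with hG
  have hGm : Measurable G := hF.comp measurable_urnStep
  have hint : Integrable G ((P.map X).prod (unitUniform.prod unitUniform)) := by
    rw [← hlaw, integrable_map_measure hGm.aestronglyMeasurable hpair]
    refine Integrable.of_bound (hGm.comp_aemeasurable hpair).aestronglyMeasurable C ?_
    filter_upwards [hXn, ae_mem_Icc_of_isUniform_unit hξ] with ω h1 h2
    exact hC _ (urnStep_mem_urnStates h1 h2)
  have := Measure.isProbabilityMeasure_map hX
  calc ∫ ω, F (urnStep (fun x => x) (ξ ω) (ξ ω) (U ω) (X ω)) ∂P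
      = ∫ w, G w ∂(P.map (fun ω => (X ω, (ξ ω, U ω)))) :=
        (integral_map hpair hGm.aestronglyMeasurable).symm
    _ = ∫ s, ∫ w, G (s, w) ∂(unitUniform.prod unitUniform) ∂(P.map X) := by
        rw [hlaw, integral_prod _ hint]
    _ = ∫ ω, ∫ w, G (X ω, w) ∂(unitUniform.prod unitUniform) ∂P :=
        integral_map hX hint.integral_prod_left.aestronglyMeasurable
    _ = ∫ ω, jumpMean F (X ω) ∂P := by
        refine integral_congr_ae ?_
        filter_upwards [hXn] with ω hω
        exact integral_urnStep_eq_jumpMean hω hF hC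

/-! ### The urn process as a chain -/

/-- A sequence of random states which evolves, in the sense of means of bounded measurable functions,
by the transition operator `jumpMean`. This is all that the proof uses of the urn process. -/
structure IsUrnChain {Ω : Type*} [MeasurableSpace Ω] (P : Measure Ω)
    (X : ℕ → Ω → ℝ × ℝ × ℝ) : Prop where
  aemeasurable : ∀ n, AEMeasurable (X n) P
  mem_urnStates : ∀ n, ∀ᵐ ω ∂P, X n ω ∈ urnStates n
  integral_succ : ∀ (n : ℕ) (F : ℝ × ℝ × ℝ → ℝ), Measurable F → ∀ C : ℝ,
    (∀ s ∈ urnStates (n + 1), |F s| ≤ C) →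
      ∫ ω, F (X (n + 1) ω) ∂P = ∫ ω, jumpMean F (X n ω) ∂P

/-- The state after `n` steps is a measurable function of the initial position and of the first `n`
driving variables. -/
lemma exists_measurable_urnProcess_eq {Ω : Type*} (Z₁ : Ω → ℝ) (ξ U : ℕ → Ω → ℝ)
    (S : Finset (Unit ⊕ ℕ ⊕ ℕ)) (h0 : Sum.inl () ∈ S) (n : ℕ)
    (hS : ∀ i < n, Sum.inr (Sum.inl i) ∈ S ∧ Sum.inr (Sum.inr i) ∈ S) :
    ∃ φ : (S → ℝ) → ℝ × ℝ × ℝ, Measurable φ ∧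
      urnProcess (fun x => x) Z₁ ξ ξ U n =
        φ ∘ fun ω (i : S) => Sum.elim (fun _ : Unit => Z₁) (Sum.elim ξ U) i ω := by
  induction n with
  | zero => exact ⟨fun y => (y ⟨_, h0⟩, 1, 1), by fun_prop, rfl⟩
  | succ n ih =>
    obtain ⟨φ, hφ, h⟩ := ih fun i hi => hS i (hi.trans n.lt_succ_self)
    obtain ⟨h1, h2⟩ := hS n n.lt_succ_self
    refine ⟨fun y => urnStep (fun x => x) (y ⟨_, h1⟩) (y ⟨_, h1⟩) (y ⟨_, h2⟩) (φ y), ?_, ?_⟩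
    · have : Measurable fun y : S → ℝ => (φ y, (y ⟨_, h1⟩, y ⟨_, h2⟩)) := by fun_prop
      exact measurable_urnStep.comp this
    · funext ω
      simp [urnProcess, h]

lemma isUrnChain_urnProcess {Ω : Type*} [MeasurableSpace Ω] {P : Measure Ω}
    [IsProbabilityMeasure P] {Z₁ : Ω → ℝ} {ξ U : ℕ → Ω → ℝ}
    (hZ₁_meas : AEMeasurable Z₁ P) (hZ₁_mem : ∀ᵐ ω ∂P, Z₁ ω ∈ Set.Icc (0 : ℝ) 1)
    (hξ : ∀ n, pdf.IsUniform (ξ n) (Set.Icc (0 : ℝ) 1) P volume)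
    (hU : ∀ n, pdf.IsUniform (U n) (Set.Icc (0 : ℝ) 1) P volume)
    (hindep : iIndepFun (Sum.elim (fun _ : Unit => Z₁) (Sum.elim ξ U)) P) :
    IsUrnChain P (urnProcess (fun x => x) Z₁ ξ ξ U) := by
  have hfm : ∀ i, AEMeasurable (Sum.elim (fun _ : Unit => Z₁) (Sum.elim ξ U) i) P := by
    rintro (i | i | i)
    exacts [hZ₁_meas, aemeasurable_of_isUniform_unit (hξ i), aemeasurable_of_isUniform_unit (hU i)]
  have hmem : ∀ n, ∀ᵐ ω ∂P, urnProcess (fun x => x) Z₁ ξ ξ U n ω ∈ urnStates n := by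
    intro n
    induction n with
    | zero =>
      filter_upwards [hZ₁_mem] with ω hω
      exact ⟨hω, by simp [urnProcess], by simp [urnProcess]⟩
    | succ n ih =>
      filter_upwards [ih, ae_mem_Icc_of_isUniform_unit (hξ n)] with ω h1 h2
      exact urnStep_mem_urnStates h1 h2
  -- The indices of the variables that determine the state after `n` steps.
  let S : ℕ → Finset (Unit ⊕ ℕ ⊕ ℕ) := fun n =>
    insert (Sum.inl ()) ((Finset.range n).image (fun i => Sum.inr (Sum.inl i)) ∪
      (Finset.range n).image (fun i => Sum.inr (Sum.inr i)))
  have hφ := fun n => exists_measurable_urnProcess_eq Z₁ ξ U (S n) (by simp [S]) n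
    (fun i hi => by simp [S, hi])
  have hmeas : ∀ n, AEMeasurable (urnProcess (fun x => x) Z₁ ξ ξ U n) P := by
    intro n
    obtain ⟨φ, hφm, h⟩ := hφ n
    rw [h]
    exact hφm.comp_aemeasurable (aemeasurable_pi_lambda _ fun i => hfm i)
  refine ⟨hmeas, hmem, fun n F hF C hC => ?_⟩
  have hξU : IndepFun (ξ n) (U n) P :=
    hindep.indepFun (i := Sum.inr (Sum.inl n)) (j := Sum.inr (Sum.inr n)) (by simp)
  refine integral_comp_urnStep (hmeas n) (hmem n) (hξ n) (hU n) ?_ hξU hF hC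
  let T : Finset (Unit ⊕ ℕ ⊕ ℕ) := {Sum.inr (Sum.inl n), Sum.inr (Sum.inr n)}
  have hST : Disjoint (S n) T := by simp [S, T]
  have h1 : Sum.inr (Sum.inl n) ∈ T := by simp [T]
  have h2 : Sum.inr (Sum.inr n) ∈ T := by simp [T]
  obtain ⟨φ, hφm, h⟩ := hφ n
  rw [h]
  exact (hindep.indepFun_finset₀ (S n) T hST hfm).comp hφm
    (ψ := fun y : T → ℝ => (y ⟨_, h1⟩, y ⟨_, h2⟩)) (by fun_prop)

/-! ### The transition operator on powers of the position -/

lemma integral_mul_one_sub_pow (z : ℝ) (k : ℕ) :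
    ∫ x in (0 : ℝ)..1, (z * (1 - x)) ^ k = z ^ k / (k + 1) := by
  have h := intervalIntegral.integral_comp_sub_left (fun y : ℝ => y ^ k) (a := 0) (b := 1) 1
  simp only [mul_pow, intervalIntegral.integral_const_mul, h, sub_self, sub_zero, integral_pow]
  simp [div_eq_mul_inv]

lemma integral_add_one_sub_mul_pow (z : ℝ) (k : ℕ) :
    ∫ x in (0 : ℝ)..1, (z + (1 - z) * x) ^ k =
      (∑ j ∈ Finset.range (k + 1), z ^ j) / (k + 1) := by
  rcases eq_or_ne z 1 with rfl | hz
  · have : (k : ℝ) + 1 ≠ 0 := by positivity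
    simp [this]
  have h := intervalIntegral.mul_integral_comp_add_mul (f := fun y : ℝ => y ^ k) (a := 0)
    (b := 1) (1 - z) z
  simp only [mul_zero, add_zero, mul_one, add_sub_cancel, integral_pow, one_pow] at h
  have hz' : 1 - z ≠ 0 := sub_ne_zero.2 hz.symm
  apply mul_left_cancel₀ hz'
  rw [h, ← mul_div_assoc, ← mul_neg_geom_sum, mul_comm]

lemma jumpMean_pow {s : ℝ × ℝ × ℝ} (hs : 0 < s.2.1 + s.2.2) (k : ℕ) :
    jumpMean (fun s => s.1 ^ k) s =
      (s.1 ^ k + s.2.2 / (s.2.1 + s.2.2) * ∑ j ∈ Finset.range k, s.1 ^ j) / (k + 1) := by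
  simp only [jumpMean, integral_mul_one_sub_pow, integral_add_one_sub_mul_pow,
    Finset.sum_range_succ]
  field_simp
  ring

/-! ### Lyapunov functions for the urn -/

/-- The Lyapunov function `M² / S^{3/2} + S^{-1/2}`, where `S = L + R` is the content of the urn and
`M = L - R + 2 Z`, which is a martingale along the chain. -/
noncomputable def urnEnergy (s : ℝ × ℝ × ℝ) : ℝ :=
  (s.2.1 - s.2.2 + 2 * s.1) ^ 2 / ((s.2.1 + s.2.2) * √(s.2.1 + s.2.2)) + 1 / √(s.2.1 + s.2.2)

lemma integral_sq_add_mul_sub (m a : ℝ) :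
    ∫ x in (0 : ℝ)..1, (m + a * (1 - 2 * x)) ^ 2 = m ^ 2 + a ^ 2 / 3 := by
  have h : ∀ x ∈ Set.uIcc (0 : ℝ) 1,
      HasDerivAt (fun x => m ^ 2 * x + 2 * m * a * (x - x ^ 2) +
        a ^ 2 * (x - 2 * x ^ 2 + 4 / 3 * x ^ 3)) ((m + a * (1 - 2 * x)) ^ 2) x := by
    intro x _
    have h1 := hasDerivAt_id' x
    have h2 := hasDerivAt_pow 2 x
    have h3 := hasDerivAt_pow 3 x
    refine (((h1.const_mul (m ^ 2)).add ((h1.sub h2).const_mul (2 * m * a))).add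
      (((h1.sub (h2.const_mul 2)).add (h3.const_mul (4 / 3))).const_mul (a ^ 2))).congr_deriv ?_
    push_cast
    ring
  rw [intervalIntegral.integral_eq_sub_of_hasDerivAt h
    (Continuous.intervalIntegrable (by fun_prop) _ _)]
  ring

/-- When the content of the urn grows by `a` and the square of the martingale by `a² / 3` in the mean,
the energy does not grow. -/
lemma energy_step_le {S a : ℝ} (m : ℝ) (hS : 0 < S) (ha : 0 ≤ a) (ha1 : a ≤ 1) :
    (m ^ 2 + a ^ 2 / 3) / ((S + a) * √(S + a)) + 1 / √(S + a) ≤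
      m ^ 2 / (S * √S) + 1 / √S := by
  obtain ⟨s, hs0, hs⟩ : ∃ s, 0 < s ∧ S = s ^ 2 :=
    ⟨√S, Real.sqrt_pos.2 hS, (Real.sq_sqrt hS.le).symm⟩
  obtain ⟨t, ht0, ht⟩ : ∃ t, 0 < t ∧ S + a = t ^ 2 :=
    ⟨√(S + a), Real.sqrt_pos.2 (by linarith), (Real.sq_sqrt (by linarith)).symm⟩
  have hst : s ≤ t := by nlinarith
  rw [ht, hs, Real.sqrt_sq hs0.le, Real.sqrt_sq ht0.le, add_div]
  have h1 : m ^ 2 / (t ^ 2 * t) ≤ m ^ 2 / (s ^ 2 * s) := by gcongr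
  have h2 : a ^ 2 / 3 / (t ^ 2 * t) + 1 / t ≤ 1 / s := by
    have ha2 : a ^ 2 ≤ t ^ 2 - s ^ 2 := by nlinarith
    rw [div_div, div_add_div _ _ (by positivity) (by positivity),
      div_le_div_iff₀ (by positivity) (by positivity)]
    have : 0 ≤ (t - s) * (3 * t ^ 2 - s * (t + s)) := by
      apply mul_nonneg <;> nlinarith
    nlinarith [mul_le_mul_of_nonneg_right ha2 (mul_pos ht0 hs0).le, mul_nonneg ht0.le this]
  linarith

lemma jumpMean_urnEnergy_le {n : ℕ} {s : ℝ × ℝ × ℝ} (hs : s ∈ urnStates n) :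
    jumpMean urnEnergy s ≤ urnEnergy s := by
  have hS := urnStates_pos hs
  obtain ⟨⟨hz0, hz1⟩, ⟨hl, -⟩, ⟨hr, -⟩⟩ := hs
  obtain ⟨z, l, r⟩ := s
  simp only at hS hz0 hz1 hl hr
  have key : ∀ a c : ℝ, 0 ≤ a → a ≤ 1 → c ^ 2 = a ^ 2 →
      (∫ x in (0 : ℝ)..1, ((l - r + 2 * z + c * (1 - 2 * x)) ^ 2 /
        ((l + r + a) * √(l + r + a)) + 1 / √(l + r + a))) ≤ urnEnergy (z, l, r) := by
    intro a c ha ha1 hc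
    rw [intervalIntegral.integral_add (Continuous.intervalIntegrable (by fun_prop) _ _)
      (by simp), intervalIntegral.integral_div, integral_sq_add_mul_sub,
      hc]
    simpa [urnEnergy] using energy_step_le (l - r + 2 * z) hS ha ha1
  have e1 : ∫ x in (0 : ℝ)..1, urnEnergy (z * (1 - x), l + z, r) ≤ urnEnergy (z, l, r) := by
    refine le_of_eq_of_le (intervalIntegral.integral_congr fun x _ => ?_) (key z z hz0 hz1 rfl)
    simp only [urnEnergy]
    rw [show l + z + r = l + r + z by ring,
      show l + z - r + 2 * (z * (1 - x)) = l - r + 2 * z + z * (1 - 2 * x) by ring]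
  have e2 : ∫ x in (0 : ℝ)..1, urnEnergy (z + (1 - z) * x, l, r + (1 - z)) ≤
      urnEnergy (z, l, r) := by
    refine le_of_eq_of_le (intervalIntegral.integral_congr fun x _ => ?_)
      (key (1 - z) (-(1 - z)) (by linarith) (by linarith) (neg_sq _))
    simp only [urnEnergy]
    rw [show l + (r + (1 - z)) = l + r + (1 - z) by ring,
      show l - (r + (1 - z)) + 2 * (z + (1 - z) * x) =
        l - r + 2 * z + -(1 - z) * (1 - 2 * x) by ring]
  have hsum : l / (l + r) + r / (l + r) = 1 := by field_simp
  calc jumpMean urnEnergy (z, l, r)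
      ≤ urnEnergy (z, l, r) * (l / (l + r)) + urnEnergy (z, l, r) * (r / (l + r)) := by
        unfold jumpMean
        gcongr
    _ = urnEnergy (z, l, r) := by rw [← mul_add, hsum, mul_one]

/-- The mean of `S⁻¹` decreases by at least `S⁻³ / 2` in one step: since `L, R ≥ 1`, the mean growth of
`S` is at least `(Z + (1 - Z)) / S`. -/
lemma jumpMean_inv_le {n : ℕ} {s : ℝ × ℝ × ℝ} (hs : s ∈ urnStates n) :
    jumpMean (fun s => 1 / (s.2.1 + s.2.2)) s ≤
      1 / (s.2.1 + s.2.2) - 1 / 2 * (1 / (s.2.1 + s.2.2) ^ 3) := by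
  have hS := urnStates_pos hs
  obtain ⟨⟨hz0, hz1⟩, ⟨hl, -⟩, ⟨hr, -⟩⟩ := hs
  obtain ⟨z, l, r⟩ := s
  simp only at hS hz0 hz1 hl hr
  have key : ∀ a : ℝ, 0 ≤ a → a ≤ 1 →
      1 / (l + r + a) ≤ 1 / (l + r) - a / (2 * (l + r) ^ 2) := by
    intro a ha ha1
    rw [div_sub_div _ _ (by positivity) (by positivity),
      div_le_div_iff₀ (by positivity) (by positivity)]
    nlinarith [mul_nonneg (mul_nonneg ha hS.le) (by linarith : 0 ≤ l + r - a)]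
  have h1 := key z hz0 hz1
  have h2 := key (1 - z) (by linarith) (by linarith)
  simp only [jumpMean, intervalIntegral.integral_const, sub_zero, one_smul]
  rw [show l + z + r = l + r + z by ring, show l + (r + (1 - z)) = l + r + (1 - z) by ring]
  have h3 := mul_le_mul_of_nonneg_right h1 (by positivity : 0 ≤ l / (l + r))
  have h4 := mul_le_mul_of_nonneg_right h2 (by positivity : 0 ≤ r / (l + r))
  refine (add_le_add h3 h4).trans ?_
  have h5 : 1 / (l + r) - 1 / 2 * (1 / (l + r) ^ 3) -
      ((1 / (l + r) - z / (2 * (l + r) ^ 2)) * (l / (l + r)) +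
        (1 / (l + r) - (1 - z) / (2 * (l + r) ^ 2)) * (r / (l + r))) =
      (z * (l - 1) + (1 - z) * (r - 1)) / (2 * (l + r) ^ 3) := by
    field_simp
    ring
  have h6 : 0 ≤ (z * (l - 1) + (1 - z) * (r - 1)) / (2 * (l + r) ^ 3) := by
    have : 0 ≤ z * (l - 1) + (1 - z) * (r - 1) := by
      have := mul_nonneg hz0 (sub_nonneg.2 hl)
      have := mul_nonneg (sub_nonneg.2 hz1) (sub_nonneg.2 hr)
      linarith
    positivity
  linarith

lemma measurable_urnEnergy : Measurable urnEnergy := by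
  unfold urnEnergy
  fun_prop

lemma urnEnergy_nonneg {n : ℕ} {s : ℝ × ℝ × ℝ} (hs : s ∈ urnStates n) : 0 ≤ urnEnergy s := by
  have hS := urnStates_pos hs
  unfold urnEnergy
  positivity

lemma urnEnergy_le {n : ℕ} {s : ℝ × ℝ × ℝ} (hs : s ∈ urnStates n) :
    urnEnergy s ≤ (2 * (n + 1)) ^ 2 + 1 := by
  have hS := urnStates_pos hs
  obtain ⟨⟨hz0, hz1⟩, ⟨hl, hl'⟩, ⟨hr, hr'⟩⟩ := hs
  obtain ⟨z, l, r⟩ := s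
  simp only [urnEnergy] at *
  have h1 : 1 ≤ √(l + r) := Real.one_le_sqrt.2 (by linarith)
  refine add_le_add ?_ ?_
  · calc (l - r + 2 * z) ^ 2 / ((l + r) * √(l + r)) ≤ (l - r + 2 * z) ^ 2 :=
        div_le_self (sq_nonneg _) (by nlinarith)
      _ ≤ (2 * (n + 1)) ^ 2 := sq_le_sq' (by linarith) (by linarith)
  · exact (div_le_one (by linarith)).2 h1

/-- A small multiple of the energy controls the deviation of the jump probability from `1 / 2`, up to
an error that vanishes as the content of the urn grows. -/
lemma exists_abs_sub_half_le {η : ℝ} (hη : 0 < η) :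
    ∃ C : ℝ, ∀ (n : ℕ), ∀ s ∈ urnStates n,
      |s.2.2 / (s.2.1 + s.2.2) - 1 / 2| ≤
        η * urnEnergy s + η + C * (1 / (s.2.1 + s.2.2) ^ 3) := by
  -- `w = S^{-1/2}`; the three terms come from `|M| / S ≤ η M² w³ + w / (4 η)` and
  -- `w ≤ δ + w⁶ / δ⁵`, with `δ` so small that `K δ = η`.
  set K : ℝ := 1 / (4 * η) + 1 with hK
  have hK0 : 0 < K := by positivity
  set δ : ℝ := η / K with hδ
  have hδ0 : 0 < δ := by positivity
  refine ⟨K / δ ^ 5, fun n s hs => ?_⟩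
  have hS := urnStates_pos hs
  obtain ⟨⟨hz0, hz1⟩, ⟨hl, -⟩, ⟨hr, -⟩⟩ := hs
  obtain ⟨z, l, r⟩ := s
  simp only [urnEnergy] at *
  obtain ⟨w, hw0, hw⟩ : ∃ w, 0 < w ∧ w = 1 / √(l + r) := ⟨_, by positivity, rfl⟩
  have hwS : 1 / (l + r) = w ^ 2 := by rw [hw, div_pow, Real.sq_sqrt hS.le, one_pow]
  have hw1 : w ≤ 1 := by
    rw [hw]
    exact (div_le_one (by positivity)).2 (Real.one_le_sqrt.2 (by linarith))
  have hw6 : 1 / (l + r) ^ 3 = w ^ 6 := by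
    rw [← one_div_pow, hwS]; ring
  have hV : (l - r + 2 * z) ^ 2 / ((l + r) * √(l + r)) = (l - r + 2 * z) ^ 2 * w ^ 3 := by
    rw [div_eq_mul_one_div, ← one_div_mul_one_div, hwS, ← hw]
    ring
  rw [hw6, hV, ← hw]
  set M := l - r + 2 * z with hM
  have h1 : |r / (l + r) - 1 / 2| ≤ |M| * w ^ 2 + w ^ 2 := by
    have : r / (l + r) - 1 / 2 = (2 * z - M) / 2 * w ^ 2 := by
      rw [← hwS, hM]; field_simp; ring
    rw [this, abs_mul, abs_of_nonneg (sq_nonneg w), ← add_one_mul]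
    gcongr
    rw [abs_le]
    constructor <;> cases abs_cases M <;> linarith
  have h2 : |M| * w ^ 2 ≤ η * (M ^ 2 * w ^ 3) + w / (4 * η) := by
    have : η * (M ^ 2 * w ^ 3) + w / (4 * η) - |M| * w ^ 2 =
        w * η * (|M| * w - 1 / (2 * η)) ^ 2 := by
      rw [← sq_abs M]; field_simp; ring
    have : 0 ≤ w * η * (|M| * w - 1 / (2 * η)) ^ 2 := by positivity
    linarith
  have h3 : w ^ 2 ≤ w := by nlinarith
  have h4 : w ≤ δ + w ^ 6 / δ ^ 5 := by
    rcases le_total w δ with h | h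
    · have : 0 ≤ w ^ 6 / δ ^ 5 := by positivity
      linarith
    · have : w * δ ^ 5 ≤ w ^ 6 := by
        have := pow_le_pow_left₀ hδ0.le h 5
        nlinarith
      have : w ≤ w ^ 6 / δ ^ 5 := (le_div_iff₀ (by positivity)).2 this
      linarith
  have h5 : K * w ≤ η + K / δ ^ 5 * w ^ 6 := by
    calc K * w ≤ K * (δ + w ^ 6 / δ ^ 5) := by gcongr
      _ = η + K / δ ^ 5 * w ^ 6 := by
        rw [mul_add, hδ, mul_div_cancel₀ _ hK0.ne']; ring
  have h6 : w / (4 * η) + w = K * w := by rw [hK]; ring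
  have h7 : 0 ≤ η * w := by positivity
  linarith

/-! ### Bounds on the reachable states -/

lemma jumpMean_nonneg {n : ℕ} {s : ℝ × ℝ × ℝ} (hs : s ∈ urnStates n) {F : ℝ × ℝ × ℝ → ℝ}
    (hF : ∀ s ∈ urnStates (n + 1), 0 ≤ F s) : 0 ≤ jumpMean F s := by
  have hS := urnStates_pos hs
  have hl : 0 ≤ s.2.1 := zero_le_one.trans hs.2.1.1
  have hr : 0 ≤ s.2.2 := zero_le_one.trans hs.2.2.1
  have h1 := intervalIntegral.integral_nonneg zero_le_one (μ := volume)
    fun x hx => hF _ (left_mem_urnStates hs hx)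
  have h2 := intervalIntegral.integral_nonneg zero_le_one (μ := volume)
    fun x hx => hF _ (right_mem_urnStates hs hx)
  unfold jumpMean
  positivity

lemma abs_inv_total_pow_le_one {n : ℕ} {s : ℝ × ℝ × ℝ} (hs : s ∈ urnStates n) (k : ℕ) :
    |1 / (s.2.1 + s.2.2) ^ k| ≤ 1 := by
  have hS : 1 ≤ s.2.1 + s.2.2 := by linarith [hs.2.1.1, hs.2.2.1]
  rw [abs_of_nonneg (by positivity)]
  exact (div_le_one (by positivity)).2 (one_le_pow₀ hS)

lemma right_prob_mem_Icc {n : ℕ} {s : ℝ × ℝ × ℝ} (hs : s ∈ urnStates n) :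
    s.2.2 / (s.2.1 + s.2.2) ∈ Set.Icc (0 : ℝ) 1 := by
  have hS := urnStates_pos hs
  have hl : 0 ≤ s.2.1 := zero_le_one.trans hs.2.1.1
  have hr : 0 ≤ s.2.2 := zero_le_one.trans hs.2.2.1
  exact ⟨by positivity, (div_le_one hS).2 (by linarith)⟩

lemma abs_position_pow_le_one {n : ℕ} {s : ℝ × ℝ × ℝ} (hs : s ∈ urnStates n) (k : ℕ) :
    |s.1 ^ k| ≤ 1 := by
  rw [abs_of_nonneg (pow_nonneg hs.1.1 k)]
  exact pow_le_one₀ hs.1.1 hs.1.2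

/-- A sequence with `x (n + 1) = c * x n + e n`, `0 ≤ c < 1`, converges as soon as `e` does. -/
lemma tendsto_of_contracting_recursion {x e : ℕ → ℝ} {c L : ℝ} (hc0 : 0 ≤ c) (hc1 : c < 1)
    (hx : ∀ n, x (n + 1) = c * x n + e n) (he : Tendsto e atTop (nhds ((1 - c) * L))) :
    Tendsto x atTop (nhds L) := by
  rw [Metric.tendsto_atTop] at he ⊢
  intro ε hε
  have hc : 0 < 1 - c := by linarith
  obtain ⟨N, hN⟩ := he ((1 - c) * (ε / 2)) (by positivity)
  have hstep : ∀ m, dist (x (N + m)) L ≤ c ^ m * dist (x N) L + ε / 2 := by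
    intro m
    induction m with
    | zero => simp; positivity
    | succ m ih =>
      have h1 := (hN (N + m) (by omega)).le
      rw [Real.dist_eq] at h1 ih ⊢
      calc |x (N + (m + 1)) - L| = |c * (x (N + m) - L) + (e (N + m) - (1 - c) * L)| := by
            rw [← add_assoc, hx]; ring_nf
        _ ≤ c * |x (N + m) - L| + |e (N + m) - (1 - c) * L| := by
            refine (abs_add_le _ _).trans ?_
            rw [abs_mul, abs_of_nonneg hc0]
        _ ≤ c * (c ^ m * dist (x N) L + ε / 2) + (1 - c) * (ε / 2) := by gcongr
        _ = c ^ (m + 1) * dist (x N) L + ε / 2 := by ring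
  have hlim : Tendsto (fun m : ℕ => c ^ m * dist (x N) L) atTop (nhds 0) := by
    simpa using (tendsto_pow_atTop_nhds_zero_of_lt_one hc0 hc1).mul_const (dist (x N) L)
  obtain ⟨m₀, hm₀⟩ := eventually_atTop.1 (hlim.eventually_lt_const (half_pos hε))
  refine ⟨N + m₀, fun n hn => ?_⟩
  obtain ⟨m, rfl⟩ : ∃ m, n = N + m := ⟨n - N, by omega⟩
  have h1 := hstep m
  have h2 := hm₀ m (by omega)
  linarith

/-! ### Asymptotics of the chain -/

namespace IsUrnChain

variable {Ω : Type*} [MeasurableSpace Ω] {P : Measure Ω} [IsProbabilityMeasure P]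
  {X : ℕ → Ω → ℝ × ℝ × ℝ}

lemma integrable_comp (h : IsUrnChain P X) {n : ℕ} {F : ℝ × ℝ × ℝ → ℝ} (hF : Measurable F) {C : ℝ}
    (hC : ∀ s ∈ urnStates n, |F s| ≤ C) : Integrable (fun ω => F (X n ω)) P := by
  refine Integrable.of_bound (hF.comp_aemeasurable (h.aemeasurable n)).aestronglyMeasurable C ?_
  filter_upwards [h.mem_urnStates n] with ω hω
  exact hC _ hω

lemma integrable_urnEnergy (h : IsUrnChain P X) (n : ℕ) :
    Integrable (fun ω => urnEnergy (X n ω)) P :=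
  h.integrable_comp measurable_urnEnergy fun _ hs => by
    rw [abs_of_nonneg (urnEnergy_nonneg hs)]; exact urnEnergy_le hs

lemma antitone_integral_urnEnergy (h : IsUrnChain P X) :
    Antitone fun n => ∫ ω, urnEnergy (X n ω) ∂P := by
  refine antitone_nat_of_succ_le fun n => ?_
  rw [h.integral_succ n urnEnergy measurable_urnEnergy _ fun s hs => by
    rw [abs_of_nonneg (urnEnergy_nonneg hs)]; exact urnEnergy_le hs]
  refine integral_mono_of_nonneg ?_ (h.integrable_urnEnergy n) ?_
  · filter_upwards [h.mem_urnStates n] with ω hω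
    exact jumpMean_nonneg hω fun _ => urnEnergy_nonneg
  · filter_upwards [h.mem_urnStates n] with ω hω
    exact jumpMean_urnEnergy_le hω

lemma integrable_inv_pow (h : IsUrnChain P X) (n k : ℕ) :
    Integrable (fun ω => 1 / ((X n ω).2.1 + (X n ω).2.2) ^ k) P :=
  h.integrable_comp (F := fun s => 1 / (s.2.1 + s.2.2) ^ k) (by fun_prop)
    fun _ hs => abs_inv_total_pow_le_one hs k

/-- The content of the urn tends to infinity, in the sense that the mean of `S⁻³` vanishes: this mean
is at most twice the decrement of the mean of `S⁻¹`. -/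
lemma tendsto_integral_inv_cube (h : IsUrnChain P X) :
    Tendsto (fun n => ∫ ω, 1 / ((X n ω).2.1 + (X n ω).2.2) ^ 3 ∂P) atTop (nhds 0) := by
  set a : ℕ → ℝ := fun n => ∫ ω, 1 / ((X n ω).2.1 + (X n ω).2.2) ∂P with ha
  set b : ℕ → ℝ := fun n => ∫ ω, 1 / ((X n ω).2.1 + (X n ω).2.2) ^ 3 ∂P with hb
  have ha0 : ∀ n, 0 ≤ a n := fun n => integral_nonneg_of_ae <| by
    filter_upwards [h.mem_urnStates n] with ω hω
    have := urnStates_pos hω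
    simp only [Pi.zero_apply]
    positivity
  have hb0 : ∀ n, 0 ≤ b n := fun n => integral_nonneg_of_ae <| by
    filter_upwards [h.mem_urnStates n] with ω hω
    have := urnStates_pos hω
    simp only [Pi.zero_apply]
    positivity
  have hi : ∀ n, Integrable (fun ω => 1 / ((X n ω).2.1 + (X n ω).2.2)) P := fun n => by
    simpa using h.integrable_inv_pow n 1
  have hab : ∀ n, a (n + 1) ≤ a n - 1 / 2 * b n := by
    intro n
    simp only [ha, hb]
    rw [h.integral_succ n (fun s => 1 / (s.2.1 + s.2.2)) (by fun_prop) 1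
      fun s hs => by simpa using abs_inv_total_pow_le_one hs 1, ← integral_const_mul,
      ← integral_sub (hi n) ((h.integrable_inv_pow n 3).const_mul _)]
    refine integral_mono_of_nonneg ?_ ((hi n).sub ((h.integrable_inv_pow n 3).const_mul _)) ?_
    · filter_upwards [h.mem_urnStates n] with ω hω
      refine jumpMean_nonneg hω fun s hs => ?_
      have := urnStates_pos hs
      positivity
    · filter_upwards [h.mem_urnStates n] with ω hω
      exact jumpMean_inv_le hω
  have hanti : Antitone a := antitone_nat_of_succ_le fun n => by linarith [hab n, hb0 n]
  obtain ⟨l, hl⟩ : ∃ l, Tendsto a atTop (nhds l) :=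
    ⟨_, tendsto_atTop_ciInf hanti ⟨0, by rintro _ ⟨n, rfl⟩; exact ha0 n⟩⟩
  have hlim : Tendsto (fun n => 2 * (a n - a (n + 1))) atTop (nhds 0) := by
    simpa using (hl.sub (hl.comp (tendsto_add_atTop_nat 1))).const_mul 2
  exact squeeze_zero hb0 (fun n => by linarith [hab n]) hlim

lemma integrable_right_prob_sub (h : IsUrnChain P X) (n : ℕ) :
    Integrable (fun ω => |(X n ω).2.2 / ((X n ω).2.1 + (X n ω).2.2) - 1 / 2|) P :=
  h.integrable_comp (F := fun s => |s.2.2 / (s.2.1 + s.2.2) - 1 / 2|) (C := 1) (by fun_prop)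
    fun s hs => by
      obtain ⟨h0, h1⟩ := right_prob_mem_Icc hs
      rw [abs_abs, abs_le]
      constructor <;> linarith

/-- The probability of a jump to the right converges to `1 / 2` in mean. -/
lemma tendsto_integral_abs_right_prob_sub (h : IsUrnChain P X) :
    Tendsto (fun n => ∫ ω, |(X n ω).2.2 / ((X n ω).2.1 + (X n ω).2.2) - 1 / 2| ∂P) atTop
      (nhds 0) := by
  set V := ∫ ω, urnEnergy (X 0 ω) ∂P with hV
  have hV0 : 0 ≤ V := integral_nonneg_of_ae <| by
    filter_upwards [h.mem_urnStates 0] with ω hω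
    exact urnEnergy_nonneg hω
  rw [Metric.tendsto_atTop]
  intro ε hε
  set η := ε / (2 * (V + 1)) with hη
  have hη0 : 0 < η := by positivity
  obtain ⟨C, hC⟩ := exists_abs_sub_half_le hη0
  have hlim : Tendsto (fun n => C * ∫ ω, 1 / ((X n ω).2.1 + (X n ω).2.2) ^ 3 ∂P) atTop
      (nhds 0) := by
    simpa using h.tendsto_integral_inv_cube.const_mul C
  obtain ⟨N, hN⟩ := eventually_atTop.1 (hlim.eventually_lt_const (half_pos hε))
  refine ⟨N, fun n hn => ?_⟩
  have hle : ∫ ω, |(X n ω).2.2 / ((X n ω).2.1 + (X n ω).2.2) - 1 / 2| ∂P ≤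
      ∫ ω, (η * urnEnergy (X n ω) + η + C * (1 / ((X n ω).2.1 + (X n ω).2.2) ^ 3)) ∂P := by
    refine integral_mono_ae (h.integrable_right_prob_sub n)
      ((((h.integrable_urnEnergy n).const_mul _).add (integrable_const _)).add
        ((h.integrable_inv_pow n 3).const_mul _)) ?_
    filter_upwards [h.mem_urnStates n] with ω hω
    exact hC n _ hω
  rw [integral_add (by exact ((h.integrable_urnEnergy n).const_mul _).add (integrable_const _))
    ((h.integrable_inv_pow n 3).const_mul _), integral_add ((h.integrable_urnEnergy n).const_mul _)
    (integrable_const _), integral_const_mul, integral_const_mul] at hle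
  simp only [integral_const, probReal_univ, one_smul] at hle
  have h1 : ∫ ω, urnEnergy (X n ω) ∂P ≤ V := h.antitone_integral_urnEnergy (Nat.zero_le n)
  have h2 : η * V + η = ε / 2 := by rw [hη]; field_simp
  have h3 := hN n hn
  have h4 := mul_le_mul_of_nonneg_left h1 hη0.le
  rw [Real.dist_0_eq_abs, abs_of_nonneg (integral_nonneg fun _ => abs_nonneg _)]
  linarith

lemma integrable_pow (h : IsUrnChain P X) (n k : ℕ) : Integrable (fun ω => (X n ω).1 ^ k) P :=
  h.integrable_comp (F := fun s => s.1 ^ k) (by fun_prop) fun _ hs => abs_position_pow_le_one hs k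

lemma integrable_right_prob_mul_pow (h : IsUrnChain P X) (n k : ℕ) :
    Integrable (fun ω => (X n ω).2.2 / ((X n ω).2.1 + (X n ω).2.2) * (X n ω).1 ^ k) P :=
  h.integrable_comp (F := fun s => s.2.2 / (s.2.1 + s.2.2) * s.1 ^ k) (C := 1) (by fun_prop)
    fun s hs => by
      rw [abs_mul, abs_of_nonneg (right_prob_mem_Icc hs).1]
      exact mul_le_one₀ (right_prob_mem_Icc hs).2 (abs_nonneg _) (abs_position_pow_le_one hs k)

lemma tendsto_integral_right_prob_mul_pow (h : IsUrnChain P X) {k : ℕ} {m : ℝ}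
    (hm : Tendsto (fun n => ∫ ω, (X n ω).1 ^ k ∂P) atTop (nhds m)) :
    Tendsto (fun n => ∫ ω, (X n ω).2.2 / ((X n ω).2.1 + (X n ω).2.2) * (X n ω).1 ^ k ∂P) atTop
      (nhds (1 / 2 * m)) := by
  have hdiff : Tendsto (fun n =>
      (∫ ω, (X n ω).2.2 / ((X n ω).2.1 + (X n ω).2.2) * (X n ω).1 ^ k ∂P) -
        1 / 2 * ∫ ω, (X n ω).1 ^ k ∂P) atTop (nhds 0) := by
    refine squeeze_zero_norm (fun n => ?_) h.tendsto_integral_abs_right_prob_sub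
    rw [← integral_const_mul, ← integral_sub (h.integrable_right_prob_mul_pow n k)
      ((h.integrable_pow n k).const_mul _)]
    refine norm_integral_le_of_norm_le (h.integrable_right_prob_sub n) ?_
    filter_upwards [h.mem_urnStates n] with ω hω
    rw [← sub_mul, norm_mul, Real.norm_eq_abs, Real.norm_eq_abs]
    exact mul_le_of_le_one_right (abs_nonneg _) (abs_position_pow_le_one hω k)
  have hadd := hdiff.add (hm.const_mul (1 / 2))
  rw [zero_add] at hadd
  exact hadd.congr fun n => by ring

/-- Convergence of all moments of the position. The limits `m k` are determined by
`2 k m k = m 0 + ⋯ + m (k - 1)`, which is the limit of the recursion for the moments. -/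
lemma tendsto_integral_pow (h : IsUrnChain P X) {m : ℕ → ℝ} (hm0 : m 0 = 1)
    (hm : ∀ k, 2 * k * m k = ∑ j ∈ Finset.range k, m j) (k : ℕ) :
    Tendsto (fun n => ∫ ω, (X n ω).1 ^ k ∂P) atTop (nhds (m k)) := by
  induction k using Nat.strong_induction_on with
  | _ k ih =>
    rcases Nat.eq_zero_or_pos k with rfl | hk
    · simp [hm0]
    have hk1 : (1 : ℝ) ≤ k := by exact_mod_cast hk
    have hsum : Tendsto (fun n => (∑ j ∈ Finset.range k,
        ∫ ω, (X n ω).2.2 / ((X n ω).2.1 + (X n ω).2.2) * (X n ω).1 ^ j ∂P) / (k + 1)) atTop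
        (nhds ((∑ j ∈ Finset.range k, 1 / 2 * m j) / (k + 1))) :=
      (tendsto_finsetSum _ fun j hj =>
        h.tendsto_integral_right_prob_mul_pow (ih j (Finset.mem_range.1 hj))).div_const _
    refine tendsto_of_contracting_recursion (c := 1 / (k + 1)) (by positivity)
      ((div_lt_one (by positivity)).2 (by linarith)) (fun n => ?_) ?_ (e := fun n =>
        (∑ j ∈ Finset.range k,
          ∫ ω, (X n ω).2.2 / ((X n ω).2.1 + (X n ω).2.2) * (X n ω).1 ^ j ∂P) / (k + 1))
    · rw [h.integral_succ n (fun s => s.1 ^ k) (by fun_prop) 1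
          fun s hs => abs_position_pow_le_one hs k,
        ← integral_finsetSum _ fun j _ => h.integrable_right_prob_mul_pow n j, one_div_mul_eq_div,
        ← add_div, ← integral_add (h.integrable_pow n k)
          (integrable_finsetSum _ fun j _ => h.integrable_right_prob_mul_pow n j), ← integral_div]
      refine integral_congr_ae ?_
      filter_upwards [h.mem_urnStates n] with ω hω
      rw [jumpMean_pow (urnStates_pos hω), Finset.mul_sum]
    · convert hsum using 2
      rw [← Finset.mul_sum, ← hm k]
      field_simp
      ring

end IsUrnChain

/-! ### Moments of the arcsine law -/

lemma integral_betaPDFReal {a b : ℝ} (ha : 0 < a) (hb : 0 < b) :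
    ∫ x, betaPDFReal a b x = 1 := by
  have h0 : ∀ x, 0 ≤ betaPDFReal a b x := by
    intro x
    by_cases hx : 0 < x ∧ x < 1
    · exact (betaPDFReal_pos hx.1 hx.2 ha hb).le
    · simp [betaPDFReal, hx]
  rw [integral_eq_lintegral_of_nonneg_ae (Eventually.of_forall h0)
    (measurable_betaPDFReal a b).aestronglyMeasurable]
  have := lintegral_betaPDF_eq_one ha hb
  simp only [betaPDF] at this
  simp [this]

lemma integral_pow_betaMeasure {a b : ℝ} (ha : 0 < a) (hb : 0 < b) (k : ℕ) :
    ∫ x, x ^ k ∂(betaMeasure a b) = beta (a + k) b / beta a b := by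
  have hak : 0 < a + k := by positivity
  have hβ := beta_pos ha hb
  have hβ' := beta_pos hak hb
  have hm : Measurable (betaPDF a b) := (measurable_betaPDFReal a b).ennreal_ofReal
  rw [betaMeasure, integral_withDensity_eq_integral_toReal_smul hm
    (Eventually.of_forall fun x => by simp [betaPDF])]
  calc ∫ x, (betaPDF a b x).toReal • x ^ k
      = ∫ x, beta (a + k) b / beta a b * betaPDFReal (a + k) b x := by
        congr 1 with x
        by_cases hx : 0 < x ∧ x < 1
        · rw [betaPDF, ENNReal.toReal_ofReal (betaPDFReal_pos hx.1 hx.2 ha hb).le, betaPDFReal,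
            betaPDFReal, if_pos hx, if_pos hx, show a + k - 1 = a - 1 + k by ring,
            Real.rpow_add hx.1, Real.rpow_natCast, smul_eq_mul]
          field_simp
        · simp [betaPDF, betaPDFReal, hx]
    _ = beta (a + k) b / beta a b := by
        rw [integral_const_mul, integral_betaPDFReal hak hb, mul_one]

lemma beta_add_one {a b : ℝ} (ha : 0 < a) (hb : 0 < b) :
    beta (a + 1) b = a / (a + b) * beta a b := by
  have h := (Real.Gamma_pos_of_pos (add_pos ha hb)).ne'
  have hab := (add_pos ha hb).ne'
  rw [beta, beta, Real.Gamma_add_one ha.ne', show a + 1 + b = a + b + 1 by ring,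
    Real.Gamma_add_one hab]
  field_simp

/-- The moments of the arcsine law satisfy the fixed point equation of the moment recursion. -/
lemma arcsine_moment_sum (k : ℕ) :
    2 * k * ∫ x, x ^ k ∂(betaMeasure (1 / 2) (1 / 2)) =
      ∑ j ∈ Finset.range k, ∫ x, x ^ j ∂(betaMeasure (1 / 2) (1 / 2)) := by
  induction k with
  | zero => simp
  | succ k ih =>
    rw [Finset.sum_range_succ, ← ih]
    simp only [integral_pow_betaMeasure one_half_pos one_half_pos]
    rw [Nat.cast_succ, ← add_assoc, beta_add_one (by positivity) one_half_pos]
    have : (1 / 2 + (k : ℝ) + 1 / 2) ≠ 0 := by positivity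
    field_simp
    ring

/-! ### The method of moments on the unit interval -/

lemma ae_mem_Icc_betaMeasure (a b : ℝ) : ∀ᵐ x ∂(betaMeasure a b), x ∈ Set.Icc (0 : ℝ) 1 := by
  have hm : Measurable (betaPDF a b) := (measurable_betaPDFReal a b).ennreal_ofReal
  rw [betaMeasure, ae_withDensity_iff hm]
  refine Eventually.of_forall fun x hx => ?_
  constructor
  · by_contra! h
    exact hx (betaPDF_eq_zero_of_nonpos h.le)
  · by_contra! h
    exact hx (betaPDF_eq_zero_of_one_le h.le)

lemma integrable_pow_of_ae_mem_Icc {μ : Measure ℝ} [IsFiniteMeasure μ]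
    (hμ : ∀ᵐ x ∂μ, x ∈ Set.Icc (0 : ℝ) 1) (k : ℕ) : Integrable (fun x => x ^ k) μ := by
  refine Integrable.of_bound (by fun_prop) 1 ?_
  filter_upwards [hμ] with x hx
  rw [Real.norm_of_nonneg (pow_nonneg hx.1 k)]
  exact pow_le_one₀ hx.1 hx.2

lemma integrable_eval_of_ae_mem_Icc {μ : Measure ℝ} [IsFiniteMeasure μ]
    (hμ : ∀ᵐ x ∂μ, x ∈ Set.Icc (0 : ℝ) 1) (p : Polynomial ℝ) :
    Integrable (fun x => p.eval x) μ := by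
  simp only [Polynomial.eval_eq_sum_range]
  exact integrable_finsetSum _ fun i _ => (integrable_pow_of_ae_mem_Icc hμ i).const_mul _

/-- The method of moments on `[0, 1]`: convergence of all moments implies weak convergence, by
Weierstrass approximation. -/
lemma tendsto_of_tendsto_integral_pow {μ : ℕ → ProbabilityMeasure ℝ} {ν : ProbabilityMeasure ℝ}
    (hμ : ∀ n, ∀ᵐ x ∂(μ n : Measure ℝ), x ∈ Set.Icc (0 : ℝ) 1)
    (hν : ∀ᵐ x ∂(ν : Measure ℝ), x ∈ Set.Icc (0 : ℝ) 1)
    (h : ∀ k : ℕ, Tendsto (fun n => ∫ x, x ^ k ∂(μ n : Measure ℝ)) atTop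
      (nhds (∫ x, x ^ k ∂(ν : Measure ℝ)))) :
    Tendsto μ atTop (nhds ν) := by
  rw [ProbabilityMeasure.tendsto_iff_forall_integral_tendsto]
  intro f
  have hpoly : ∀ p : Polynomial ℝ, Tendsto (fun n => ∫ x, p.eval x ∂(μ n : Measure ℝ)) atTop
      (nhds (∫ x, p.eval x ∂(ν : Measure ℝ))) := by
    intro p
    simp only [Polynomial.eval_eq_sum_range]
    rw [integral_finsetSum _ fun i _ => (integrable_pow_of_ae_mem_Icc hν i).const_mul _]
    simp only [integral_const_mul]
    refine Tendsto.congr (fun n => ?_) (tendsto_finsetSum _ fun i _ => (h i).const_mul _)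
    rw [integral_finsetSum _ fun i _ => (integrable_pow_of_ae_mem_Icc (hμ n) i).const_mul _]
    simp only [integral_const_mul]
  rw [Metric.tendsto_atTop]
  intro ε hε
  obtain ⟨p, hp⟩ := exists_polynomial_near_of_continuousOn 0 1 f f.continuous.continuousOn (ε / 3)
    (by positivity)
  have happrox : ∀ ρ : ProbabilityMeasure ℝ, (∀ᵐ x ∂(ρ : Measure ℝ), x ∈ Set.Icc (0 : ℝ) 1) →
      |∫ x, p.eval x ∂(ρ : Measure ℝ) - ∫ x, f x ∂(ρ : Measure ℝ)| ≤ ε / 3 := by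
    intro ρ hρ
    rw [← integral_sub (integrable_eval_of_ae_mem_Icc hρ p) (f.integrable _), ← Real.norm_eq_abs]
    refine (norm_integral_le_of_norm_le_const (C := ε / 3) ?_).trans (by simp)
    filter_upwards [hρ] with x hx
    exact (hp x hx).le
  obtain ⟨N, hN⟩ := Metric.tendsto_atTop.1 (hpoly p) (ε / 3) (by positivity)
  refine ⟨N, fun n hn => ?_⟩
  have h1 := abs_le.1 (happrox _ (hμ n))
  have h2 := abs_le.1 (happrox _ hν)
  have h3 := abs_lt.1 (hN n hn)
  rw [Real.dist_eq, abs_lt]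
  constructor <;> linarith

/-! ### Convergence in distribution -/

theorem mainTheorem3 {Ω : Type*} [MeasurableSpace Ω] (P : Measure Ω) [IsProbabilityMeasure P]
    (Z₁ : Ω → ℝ) (ξ U : ℕ → Ω → ℝ)
    (hZ₁_meas : AEMeasurable Z₁ P) (hZ₁_mem : ∀ᵐ ω ∂P, Z₁ ω ∈ Set.Icc (0 : ℝ) 1)
    (hξ : ∀ n, pdf.IsUniform (ξ n) (Set.Icc (0 : ℝ) 1) P volume)
    (hU : ∀ n, pdf.IsUniform (U n) (Set.Icc (0 : ℝ) 1) P volume)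
    (hindep : iIndepFun (Sum.elim (fun _ : Unit => Z₁) (Sum.elim ξ U)) P) :
    TendstoInDistribution
      (fun (n : ℕ) (ω : Ω) => (urnProcess (fun x => x) Z₁ ξ ξ U n ω).1) atTop
      (id : ℝ → ℝ) (fun _ => P) (betaMeasure (1 / 2) (1 / 2)) := by
  have hX := isUrnChain_urnProcess hZ₁_meas hZ₁_mem hξ hU hindep
  have hmeas : ∀ n, AEMeasurable (fun ω => (urnProcess (fun x => x) Z₁ ξ ξ U n ω).1) P :=
    fun n => (hX.aemeasurable n).fst
  refine ⟨hmeas, aemeasurable_id, tendsto_of_tendsto_integral_pow (fun n => ?_) ?_ fun k => ?_⟩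
  · simp only [ProbabilityMeasure.coe_mk]
    refine (ae_map_iff (hmeas n) measurableSet_Icc).2 ?_
    filter_upwards [hX.mem_urnStates n] with ω hω
    exact hω.1
  · simp only [ProbabilityMeasure.coe_mk, Measure.map_id]
    exact ae_mem_Icc_betaMeasure _ _
  · simp only [ProbabilityMeasure.coe_mk, Measure.map_id]
    refine Tendsto.congr (fun n => ?_) (hX.tendsto_integral_pow
      (m := fun k => ∫ x, x ^ k ∂(betaMeasure (1 / 2) (1 / 2)))
      (by simp only [pow_zero, integral_const, probReal_univ, smul_eq_mul, mul_one])
      arcsine_moment_sum k)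
    exact (integral_map (hmeas n) (continuous_pow k).aestronglyMeasurable).symm
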